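/- Let $d=p^m$ be a power of a prime ($p$ prime, $m\ge 1$), and let $dU$ denote the Haar probability measure on the unitary group $U(d^2)$ of the Hilbert space $\mathbb{C}^d\otimes\mathbb{C}^d$ of dimension $d^2$. Write $\operatorname{tr}_B$ for the partial trace over the second tensor factor, and for a Hermitian $d\times d$ matrix $\sigma$ let $\operatorname{tr}(\sigma^2)=\|\sigma\|_2^2$ be its purity. Then the average purity of the reduced state of a random pure state on $\mathbb{C}^d\otimes\mathbb{C}^d$ is $2d/(d^2+1)$; that is, for every unit vector $\psi\in\mathbb{C}^d\otimes\mathbb{C}^d$ the function $U\mapsto \operatorname{tr}\big[\big(\operatorname{tr}_B[\,U|\psi\rangle\langle\psi|U^\dagger\,]\big)^2\big]$ is integrable on $U(d^2)$ and $$\int_{U(d^2)} \operatorname{tr}\Big[\big(\operatorname{tr}_B[\,U|\psi\rangle\langle\psi|U^\dagger\,]\big)^2\Big]\,dU=\frac{2d}{d^2+1}.$$ -/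

import Mathlib

open MeasureTheory

/-- The unitary group `U(n)`, as a closed bounded set of matrices, is compact. -/
theorem unitaryGroup_isCompact (n : Type) [Fintype n] [DecidableEq n] :
    IsCompact (Matrix.unitaryGroup n ℂ : Set (Matrix n n ℂ)) := by
  have hK : IsCompact (Set.univ.pi fun _ : n => Set.univ.pi fun _ : n =>
      Metric.closedBall (0 : ℂ) 1) :=
    isCompact_univ_pi fun _ => isCompact_univ_pi fun _ => isCompact_closedBall 0 1
  refine hK.of_isClosed_subset ?_ ?_
  · have : (Matrix.unitaryGroup n ℂ : Set (Matrix n n ℂ)) =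
        {A : Matrix n n ℂ | A * star A = 1} := by
      ext A
      exact Matrix.mem_unitaryGroup_iff
    rw [this]
    exact isClosed_eq (by fun_prop) continuous_const
  · intro A hA i _ j _
    simpa using entry_norm_bound_of_unitary hA i j

instance unitaryGroup_compactSpace (n : Type) [Fintype n] [DecidableEq n] :
    CompactSpace (Matrix.unitaryGroup n ℂ) :=
  isCompact_iff_compactSpace.mp (unitaryGroup_isCompact n)

/-- The unitary group carries its Borel `σ`-algebra. -/
noncomputable instance unitaryGroup_measurableSpace (n : Type) [Fintype n] [DecidableEq n] :
    MeasurableSpace (Matrix.unitaryGroup n ℂ) :=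
  borel _

instance unitaryGroup_borelSpace (n : Type) [Fintype n] [DecidableEq n] :
    BorelSpace (Matrix.unitaryGroup n ℂ) :=
  ⟨rfl⟩

/-- The Haar measure of the unitary group `U(n)`, normalized to total mass one. -/
noncomputable def unitaryHaar (n : Type) [Fintype n] [DecidableEq n] :
    Measure (Matrix.unitaryGroup n ℂ) :=
  Measure.haarMeasure (⊤ : TopologicalSpace.PositiveCompacts (Matrix.unitaryGroup n ℂ))

instance unitaryHaar_isHaarMeasure (n : Type) [Fintype n] [DecidableEq n] :
    (unitaryHaar n).IsHaarMeasure :=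
  Measure.isHaarMeasure_haarMeasure _

instance unitaryHaar_isProbabilityMeasure (n : Type) [Fintype n] [DecidableEq n] :
    IsProbabilityMeasure (unitaryHaar n) :=
  ⟨by simpa [unitaryHaar] using
    Measure.haarMeasure_self (K₀ := (⊤ : TopologicalSpace.PositiveCompacts
      (Matrix.unitaryGroup n ℂ)))⟩

/-- The rank-one operator `|ψ⟩⟨ψ|`. -/
def ketBra {n : Type} (ψ : EuclideanSpace ℂ n) : Matrix n n ℂ :=
  Matrix.of fun x y => ψ x * star (ψ y)

/-- The partial trace `tr_B` over the second tensor factor. The space `ℂ^d ⊗ ℂ^d` has the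
coordinates `Fin d × Fin d`, the pair `(i, j)` standing for `|i⟩ ⊗ |j⟩`. -/
def partialTraceB {d : ℕ} (ρ : Matrix (Fin d × Fin d) (Fin d × Fin d) ℂ) :
    Matrix (Fin d) (Fin d) ℂ :=
  Matrix.of fun i i' => ∑ j, ρ (i, j) (i', j)

/-- The purity `tr (ρ²)`; for a Hermitian `ρ` this trace is real, see `ofReal_purity`. -/
def purity {d : ℕ} (ρ : Matrix (Fin d) (Fin d) ℂ) : ℝ :=
  (ρ ^ 2).trace.re

theorem ofReal_purity {d : ℕ} {ρ : Matrix (Fin d) (Fin d) ℂ} (hρ : ρ.IsHermitian) :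
    (purity ρ : ℂ) = (ρ ^ 2).trace := by
  apply Complex.conj_eq_iff_re.mp
  have h : (ρ ^ 2).IsHermitian := hρ.pow 2
  have := Matrix.trace_conjTranspose (ρ ^ 2)
  rw [h.eq] at this
  exact this.symm

/-- For a Hermitian `ρ`, the purity is the squared Hilbert–Schmidt norm. -/
theorem purity_eq_sum {d : ℕ} {ρ : Matrix (Fin d) (Fin d) ℂ} (hρ : ρ.IsHermitian) :
    purity ρ = ∑ i, ∑ j, ‖ρ i j‖ ^ 2 := by
  have h : ∀ i j, ρ i j * ρ j i = ((‖ρ i j‖ ^ 2 : ℝ) : ℂ) := fun i j => by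
    rw [← hρ.apply j i]
    simpa using Complex.mul_conj' (ρ i j)
  simp only [purity, pow_two ρ, Matrix.trace, Matrix.diag, Matrix.mul_apply, h]
  simp only [← Complex.ofReal_sum, Complex.ofReal_re]

/-! The law of `v = U ψ` is invariant under every fixed unitary, and the purity of the reduced state
is a sum of quartic monomials in `v`, so only fourth moments are needed. Unitaries acting on two
coordinates determine them. Swapping coordinates shows that `m = E|v_a|⁴` does not depend on `a`; a
Hadamard rotation and a phase give `E|v_a|²|v_b|² = m/2` for `a ≠ b`; integrating `(∑|v_a|²)² = 1`
over `N = d²` coordinates gives `m = 2/(N(N+1))`.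

A sign flip kills every monomial with `i ≠ i'` and `j ≠ j'`. The others contribute `(m/2)(d³ + d³) =
2d/(d²+1)`. -/

open Matrix in
/-- The matrix acting as `!![p, q; r, t]` on the coordinates `a`, `b` and trivially elsewhere. -/
def planarMatrix {n : Type} [DecidableEq n] (a b : n) (p q r t : ℂ) : Matrix n n ℂ :=
  1 + single a a (p - 1) + single a b q + single b a r + single b b (t - 1)

section

variable {n : Type} [Fintype n] [DecidableEq n]

/-- The hypotheses say that the columns `(p, r)` and `(q, t)` are orthonormal. -/
theorem planarMatrix_mem_unitaryGroup {a b : n} (hab : a ≠ b) {p q r t : ℂ}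
    (haa : star p * p + star r * r = 1) (h_ab : star p * q + star r * t = 0)
    (hbb : star q * q + star t * t = 1) :
    planarMatrix a b p q r t ∈ Matrix.unitaryGroup n ℂ := by
  have h_ba : star q * p + star t * r = 0 := by
    have := congrArg star h_ab
    simp only [star_add, star_mul', star_star, star_zero] at this
    linear_combination this
  rw [Matrix.mem_unitaryGroup_iff']
  have hba := hab.symm
  simp only [planarMatrix, Matrix.star_eq_conjTranspose, Matrix.conjTranspose_add,
    Matrix.conjTranspose_one, Matrix.conjTranspose_single, add_mul, mul_add, one_mul, mul_one,
    Matrix.single_mul_single_same, Matrix.single_mul_single_of_ne _ _ _ _ hab,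
    Matrix.single_mul_single_of_ne _ _ _ _ hba, add_zero]
  ext x y
  have e : ∀ (i j : n) (c : ℂ), Matrix.single i j c x y =
      c * ((if i = x then 1 else 0) * if j = y then 1 else 0) := fun i j c => by
    split_ifs <;> simp [*]
  simp only [Matrix.add_apply, e, star_sub, star_one]
  linear_combination ((if a = x then 1 else 0) * if a = y then 1 else 0) * haa +
    ((if a = x then 1 else 0) * if b = y then 1 else 0) * h_ab +
    ((if b = x then 1 else 0) * if a = y then 1 else 0) * h_ba +
    ((if b = x then 1 else 0) * if b = y then 1 else 0) * hbb

theorem planarMatrix_mulVec {a b : n} (hab : a ≠ b) (p q r t : ℂ) (v : n → ℂ) :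
    (planarMatrix a b p q r t).mulVec v a = p * v a + q * v b ∧
      (planarMatrix a b p q r t).mulVec v b = r * v a + t * v b ∧
        ∀ x, x ≠ a → x ≠ b → (planarMatrix a b p q r t).mulVec v x = v x := by
  have hba := hab.symm
  refine ⟨?_, ?_, fun x hxa hxb => ?_⟩
  all_goals
    simp only [planarMatrix, Matrix.add_mulVec, Matrix.one_mulVec, Pi.add_apply,
      Matrix.single_mulVec, Function.update_apply, Pi.zero_apply, if_true, hab, hba, if_false]
  · ring
  · ring
  · simp [hxa, hxb]

/-! ### Invariance of Haar averages -/

/-- The average of a function of the vector `U ψ` over the Haar measure. -/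
noncomputable def haarAverage (ψ : n → ℂ) (f : (n → ℂ) → ℝ) : ℝ :=
  ∫ U : Matrix.unitaryGroup n ℂ, f ((U : Matrix n n ℂ).mulVec ψ) ∂(unitaryHaar n)

theorem integrable_comp_mulVec (ψ : n → ℂ) {f : (n → ℂ) → ℝ} (hf : Continuous f) :
    Integrable (fun U : Matrix.unitaryGroup n ℂ => f ((U : Matrix n n ℂ).mulVec ψ))
      (unitaryHaar n) :=
  (hf.comp (by fun_prop)).integrable_of_hasCompactSupport (HasCompactSupport.of_compactSpace _)

/-- Left invariance of Haar measure under `U ↦ V U`. -/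
theorem haarAverage_comp_mulVec (ψ : n → ℂ) (f : (n → ℂ) → ℝ) {V : Matrix n n ℂ}
    (hV : V ∈ Matrix.unitaryGroup n ℂ) :
    haarAverage ψ (fun v => f (V.mulVec v)) = haarAverage ψ f := by
  have := integral_mul_left_eq_self (μ := unitaryHaar n)
    (fun U : Matrix.unitaryGroup n ℂ => f ((U : Matrix n n ℂ).mulVec ψ)) ⟨V, hV⟩
  simpa [haarAverage, Matrix.mulVec_mulVec] using this

theorem haarAverage_add (ψ : n → ℂ) {f g : (n → ℂ) → ℝ} (hf : Continuous f)
    (hg : Continuous g) :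
    haarAverage ψ (fun v => f v + g v) = haarAverage ψ f + haarAverage ψ g :=
  integral_add (integrable_comp_mulVec ψ hf) (integrable_comp_mulVec ψ hg)

theorem haarAverage_const_mul (ψ : n → ℂ) (c : ℝ) (f : (n → ℂ) → ℝ) :
    haarAverage ψ (fun v => c * f v) = c * haarAverage ψ f :=
  integral_const_mul _ _

theorem haarAverage_sum {ι : Type} (s : Finset ι) (ψ : n → ℂ) {f : ι → (n → ℂ) → ℝ}
    (hf : ∀ i, Continuous (f i)) :
    haarAverage ψ (fun v => ∑ i ∈ s, f i v) = ∑ i ∈ s, haarAverage ψ (f i) :=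
  integral_finsetSum _ fun i _ => integrable_comp_mulVec ψ (hf i)

/-- A function that changes sign under a unitary has zero average. -/
theorem haarAverage_eq_zero_of_odd (ψ : n → ℂ) {f : (n → ℂ) → ℝ} {V : Matrix n n ℂ}
    (hV : V ∈ Matrix.unitaryGroup n ℂ) (hf : ∀ v, f (V.mulVec v) = -f v) :
    haarAverage ψ f = 0 := by
  have h := haarAverage_comp_mulVec ψ f hV
  simp only [hf] at h
  have h' : haarAverage ψ (fun v => -f v) = -haarAverage ψ f := integral_neg _
  linarith

/-! ### Fourth moments of the coordinates -/

theorem haarAverage_fourth_moment_eq (ψ : n → ℂ) (a b : n) :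
    haarAverage ψ (fun v => Complex.normSq (v a) ^ 2) =
      haarAverage ψ (fun v => Complex.normSq (v b) ^ 2) := by
  rcases eq_or_ne a b with rfl | hab
  · rfl
  have hV : planarMatrix a b 0 1 1 0 ∈ Matrix.unitaryGroup n ℂ :=
    planarMatrix_mem_unitaryGroup hab (by simp) (by simp) (by simp)
  rw [← haarAverage_comp_mulVec ψ _ hV]
  simp [(planarMatrix_mulVec hab 0 1 1 0 _).1]

/-- The Hadamard rotation turns `v_a v_b` into `(v_a² - v_b²)/2`. Its squared modulus averages to
`m/4 + m/4`, where `m` is the common fourth moment, once the cross term is seen to vanish. -/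
theorem haarAverage_normSq_mul_normSq (ψ : n → ℂ) {a b : n} (hab : a ≠ b) :
    haarAverage ψ (fun v => Complex.normSq (v a) * Complex.normSq (v b)) =
      haarAverage ψ (fun v => Complex.normSq (v a) ^ 2) / 2 := by
  have hs : ((√2 / 2 : ℝ) : ℂ) * ((√2 / 2 : ℝ) : ℂ) = 1 / 2 := by
    rw [← Complex.ofReal_mul]
    have : √2 / 2 * (√2 / 2) = (1 / 2 : ℝ) := by
      have := Real.mul_self_sqrt (show (0 : ℝ) ≤ 2 by norm_num)
      linarith
    rw [this]
    norm_num
  set s : ℂ := ((√2 / 2 : ℝ) : ℂ) with hs_def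
  have hstar : star s = s := Complex.conj_ofReal _
  have hH : planarMatrix a b s s s (-s) ∈ Matrix.unitaryGroup n ℂ := by
    apply planarMatrix_mem_unitaryGroup hab <;> simp only [star_neg, hstar]
    · linear_combination 2 * hs
    · ring
    · linear_combination 2 * hs
  have hI : planarMatrix a b Complex.I 0 0 1 ∈ Matrix.unitaryGroup n ℂ :=
    planarMatrix_mem_unitaryGroup hab (by simp) (by simp) (by simp)
  -- The phase `v_a ↦ i v_a` changes the sign of `v_a²`.
  have hcross : haarAverage ψ (fun v => (v a ^ 2 * star (v b) ^ 2).re) = 0 := by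
    refine haarAverage_eq_zero_of_odd ψ hI fun v => ?_
    obtain ⟨h1, h2, -⟩ := planarMatrix_mulVec hab Complex.I 0 0 1 v
    rw [h1, h2, ← Complex.neg_re]
    congr 1
    simp only [zero_mul, zero_add, add_zero, one_mul, mul_pow, Complex.I_sq]
    ring
  have key : ∀ v : n → ℂ,
      Complex.normSq ((planarMatrix a b s s s (-s)).mulVec v a) *
        Complex.normSq ((planarMatrix a b s s s (-s)).mulVec v b) =
      1 / 4 * Complex.normSq (v a) ^ 2 + (1 / 4 * Complex.normSq (v b) ^ 2 +
        -1 / 2 * (v a ^ 2 * star (v b) ^ 2).re) := fun v => by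
    obtain ⟨h1, h2, -⟩ := planarMatrix_mulVec hab s s s (-s) v
    have hprod : (s * v a + s * v b) * (s * v a + -s * v b) = 1 / 2 * (v a ^ 2 - v b ^ 2) := by
      linear_combination (v a ^ 2 - v b ^ 2) * hs
    rw [h1, h2, ← Complex.normSq_mul, hprod, Complex.normSq_mul, Complex.normSq_sub]
    simp only [map_pow, Complex.star_def]
    have : Complex.normSq (1 / 2) = 1 / 4 := by norm_num [Complex.normSq_apply]
    rw [this]
    ring
  rw [← haarAverage_comp_mulVec ψ _ hH]
  simp only [key]
  have c1 : ∀ x : n, Continuous fun v : n → ℂ => (1 / 4 : ℝ) * Complex.normSq (v x) ^ 2 :=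
    fun x => by have := Complex.continuous_normSq; fun_prop
  have c2 : Continuous fun v : n → ℂ => (-1 / 2 : ℝ) * (v a ^ 2 * star (v b) ^ 2).re := by
    fun_prop
  have c3 : Continuous fun v : n → ℂ => (1 / 4 : ℝ) * Complex.normSq (v b) ^ 2 +
      -1 / 2 * (v a ^ 2 * star (v b) ^ 2).re := (c1 b).add c2
  rw [haarAverage_add ψ (c1 a) c3, haarAverage_add ψ (c1 b) c2]
  simp only [haarAverage_const_mul, hcross, haarAverage_fourth_moment_eq ψ b a]
  ring

/-- The second moments of the squared coordinates of a random unit vector. -/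
theorem haarAverage_normSq_mul_normSq_eq_ite (ψ : n → ℂ) (c a b : n) :
    haarAverage ψ (fun v => Complex.normSq (v a) * Complex.normSq (v b)) =
      haarAverage ψ (fun v => Complex.normSq (v c) ^ 2) / 2 * (1 + if a = b then 1 else 0) := by
  rw [haarAverage_fourth_moment_eq ψ c a]
  split_ifs with h
  · subst h
    simp only [← pow_two]
    ring
  · rw [haarAverage_normSq_mul_normSq ψ h]
    ring

theorem sum_normSq_mulVec_unitary (U : Matrix.unitaryGroup n ℂ) (ψ : n → ℂ) :
    ∑ x, Complex.normSq ((U : Matrix n n ℂ).mulVec ψ x) = ∑ x, Complex.normSq (ψ x) := by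
  have hU : (U : Matrix n n ℂ).conjTranspose * (U : Matrix n n ℂ) = 1 :=
    Matrix.mem_unitaryGroup_iff'.mp U.2
  have h : ∀ v : n → ℂ, ((∑ x, Complex.normSq (v x) : ℝ) : ℂ) = star v ⬝ᵥ v := fun v => by
    simp [dotProduct, Complex.normSq_eq_conj_mul_self]
  apply Complex.ofReal_injective
  rw [h, h, Matrix.star_mulVec, ← Matrix.dotProduct_mulVec, Matrix.mulVec_mulVec, hU,
    Matrix.one_mulVec]

/-- Unitaries preserve `∑|v_a|² = 1`; averaging its square gives `(m/2)(N² + N) = 1`. -/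
theorem haarAverage_fourth_moment (ψ : n → ℂ) (hψ : ∑ x, Complex.normSq (ψ x) = 1) (c : n) :
    haarAverage ψ (fun v => Complex.normSq (v c) ^ 2) =
      2 / ((Fintype.card n : ℝ) * (Fintype.card n + 1)) := by
  have h1 : haarAverage ψ
      (fun v => ∑ a, ∑ b, Complex.normSq (v a) * Complex.normSq (v b)) = 1 := by
    simp only [haarAverage, ← Finset.sum_mul_sum, sum_normSq_mulVec_unitary, hψ]
    simp
  have hc : ∀ a b : n, Continuous fun v : n → ℂ => Complex.normSq (v a) * Complex.normSq (v b) :=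
    fun a b => by have := Complex.continuous_normSq; fun_prop
  rw [haarAverage_sum _ _ fun a => continuous_finsetSum _ fun b _ => hc a b] at h1
  simp only [fun a => haarAverage_sum Finset.univ ψ (hc a),
    haarAverage_normSq_mul_normSq_eq_ite ψ c] at h1
  simp only [← Finset.mul_sum, Finset.sum_add_distrib,
    Finset.sum_ite_eq, Finset.mem_univ, if_true, Finset.sum_const, Finset.card_univ,
    nsmul_eq_mul, mul_one] at h1
  have hpos : (0 : ℝ) < Fintype.card n := by
    exact_mod_cast Fintype.card_pos_iff.mpr ⟨c⟩
  rw [eq_div_iff (by positivity)]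
  linear_combination 2 * h1

end

/-! ### Purity of the reduced state -/

theorem mul_ketBra_mul_conjTranspose_apply {n : Type} [Fintype n] (M : Matrix n n ℂ)
    (ψ : EuclideanSpace ℂ n) (x y : n) :
    (M * ketBra ψ * M.conjTranspose) x y = M.mulVec ψ x * star (M.mulVec ψ y) := by
  have h : ketBra ψ = Matrix.vecMulVec ψ (star ψ) := rfl
  rw [h, Matrix.mul_vecMulVec, Matrix.vecMulVec_mul, Matrix.vecMulVec_apply,
    ← Matrix.star_mulVec]
  rfl

/-- The summand in the coordinate expansion of the purity of the reduced state. -/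
def purityTerm {d : ℕ} (i i' j j' : Fin d) (v : Fin d × Fin d → ℂ) : ℝ :=
  (v (i, j) * star (v (i', j)) * (v (i', j') * star (v (i, j')))).re

theorem continuous_purityTerm {d : ℕ} (i i' j j' : Fin d) :
    Continuous (purityTerm i i' j j') := by
  unfold purityTerm
  fun_prop

theorem purity_partialTraceB_eq_sum {d : ℕ} (M : Matrix (Fin d × Fin d) (Fin d × Fin d) ℂ)
    (ψ : EuclideanSpace ℂ (Fin d × Fin d)) :
    purity (partialTraceB (M * ketBra ψ * M.conjTranspose)) =
      ∑ i, ∑ i', ∑ j, ∑ j', purityTerm i i' j j' (M.mulVec ψ) := by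
  simp only [purityTerm, ← mul_ketBra_mul_conjTranspose_apply]
  generalize M * ketBra ψ * M.conjTranspose = ρ
  simp only [purity, partialTraceB, pow_two, Matrix.trace, Matrix.diag, Matrix.mul_apply,
    Matrix.of_apply, Complex.re_sum, Finset.sum_mul_sum]

theorem haarAverage_purityTerm {d : ℕ} (ψ : Fin d × Fin d → ℂ) (c : Fin d × Fin d)
    (i i' j j' : Fin d) :
    haarAverage ψ (purityTerm i i' j j') =
      haarAverage ψ (fun v => Complex.normSq (v c) ^ 2) / 2 *
        ((if i = i' then 1 else 0) + if j = j' then 1 else 0) := by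
  by_cases hi : i = i'
  · subst hi
    have h : purityTerm i i j j' =
        fun v => Complex.normSq (v (i, j)) * Complex.normSq (v (i, j')) := by
      ext v
      simp only [purityTerm, Complex.star_def, Complex.mul_conj, ← Complex.ofReal_mul,
        Complex.ofReal_re]
    rw [h, haarAverage_normSq_mul_normSq_eq_ite ψ c]
    simp
  by_cases hj : j = j'
  · subst hj
    have h : purityTerm i i' j j =
        fun v => Complex.normSq (v (i, j)) * Complex.normSq (v (i', j)) := by
      ext v
      rw [purityTerm, mul_mul_mul_comm, mul_comm (star _), mul_mul_mul_comm]
      simp only [Complex.star_def, Complex.mul_conj, ← Complex.ofReal_mul, Complex.ofReal_re]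
    rw [h, haarAverage_normSq_mul_normSq_eq_ite ψ c]
    simp [hi]
  -- The four index pairs are now distinct, so negating the coordinate `(i, j)` alone negates the
  -- monomial; `(i', j)` only completes the plane.
  have hab : (i, j) ≠ (i', j) := by simp [hi]
  have hV : planarMatrix (i, j) (i', j) (-1) 0 0 1 ∈
      Matrix.unitaryGroup (Fin d × Fin d) ℂ :=
    planarMatrix_mem_unitaryGroup hab (by simp) (by simp) (by simp)
  rw [haarAverage_eq_zero_of_odd ψ hV]
  · simp [hi, hj]
  · intro v
    obtain ⟨h1, h2, h3⟩ := planarMatrix_mulVec hab (-1) 0 0 1 v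
    rw [purityTerm, h1, h2, h3 (i', j') (by simp [Ne.symm hi]) (by simp [Ne.symm hj]),
      h3 (i, j') (by simp [Ne.symm hj]) (by simp [hi]), purityTerm, ← Complex.neg_re]
    congr 1
    simp only [zero_mul, zero_add, add_zero, one_mul]
    ring

theorem continuous_sum_purityTerm (d : ℕ) :
    Continuous fun v : Fin d × Fin d → ℂ => ∑ i, ∑ i', ∑ j, ∑ j', purityTerm i i' j j' v :=
  continuous_finsetSum _ fun i _ => continuous_finsetSum _ fun i' _ =>
    continuous_finsetSum _ fun j _ => continuous_finsetSum _ fun j' _ =>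
      continuous_purityTerm i i' j j'

theorem haarAverage_sum_purityTerm {d : ℕ} (hd : 0 < d) (ψ : Fin d × Fin d → ℂ)
    (hψ : ∑ x, Complex.normSq (ψ x) = 1) :
    haarAverage ψ (fun v => ∑ i, ∑ i', ∑ j, ∑ j', purityTerm i i' j j' v) =
      2 * (d : ℝ) / ((d : ℝ) ^ 2 + 1) := by
  have hdR : (0 : ℝ) < d := by exact_mod_cast hd
  have hc3 : ∀ i i' j : Fin d, Continuous fun v => ∑ j', purityTerm i i' j j' v :=
    fun i i' j => continuous_finsetSum _ fun j' _ => continuous_purityTerm i i' j j'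
  have hc2 : ∀ i i' : Fin d, Continuous fun v => ∑ j, ∑ j', purityTerm i i' j j' v :=
    fun i i' => continuous_finsetSum _ fun j _ => hc3 i i' j
  have hc1 : ∀ i : Fin d, Continuous fun v => ∑ i', ∑ j, ∑ j', purityTerm i i' j j' v :=
    fun i => continuous_finsetSum _ fun i' _ => hc2 i i'
  have hsum : haarAverage ψ (fun v => ∑ i, ∑ i', ∑ j, ∑ j', purityTerm i i' j j' v) =
      ∑ i, ∑ i', ∑ j, ∑ j', haarAverage ψ (purityTerm i i' j j') := by
    rw [haarAverage_sum _ _ hc1]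
    refine Finset.sum_congr rfl fun i _ => ?_
    rw [haarAverage_sum _ _ (hc2 i)]
    refine Finset.sum_congr rfl fun i' _ => ?_
    rw [haarAverage_sum _ _ (hc3 i i')]
    refine Finset.sum_congr rfl fun j _ => ?_
    exact haarAverage_sum _ _ (continuous_purityTerm i i' j)
  rw [hsum]
  simp only [haarAverage_purityTerm ψ (⟨0, hd⟩, ⟨0, hd⟩), haarAverage_fourth_moment ψ hψ,
    ← Finset.mul_sum, Finset.sum_add_distrib, Finset.sum_ite_eq, Finset.mem_univ, if_true,
    Finset.sum_const, Finset.card_univ, Fintype.card_fin, nsmul_eq_mul, mul_one,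
    Fintype.card_prod, Nat.cast_mul]
  field_simp
  ring

theorem mainTheorem8 (d : ℕ) (hd : IsPrimePow d)
    (ψ : EuclideanSpace ℂ (Fin d × Fin d)) (hψ : ‖ψ‖ = 1) :
    Integrable
        (fun U : Matrix.unitaryGroup (Fin d × Fin d) ℂ =>
          purity (partialTraceB
            ((U : Matrix (Fin d × Fin d) (Fin d × Fin d) ℂ) * ketBra ψ *
              (U : Matrix (Fin d × Fin d) (Fin d × Fin d) ℂ).conjTranspose)))
        (unitaryHaar (Fin d × Fin d)) ∧
      ∫ U : Matrix.unitaryGroup (Fin d × Fin d) ℂ,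
          purity (partialTraceB
            ((U : Matrix (Fin d × Fin d) (Fin d × Fin d) ℂ) * ketBra ψ *
              (U : Matrix (Fin d × Fin d) (Fin d × Fin d) ℂ).conjTranspose))
          ∂(unitaryHaar (Fin d × Fin d)) =
        2 * (d : ℝ) / ((d : ℝ) ^ 2 + 1) := by
  have hnorm : ∑ x, Complex.normSq (ψ x) = 1 := by
    have := EuclideanSpace.norm_sq_eq ψ
    simpa [hψ, Complex.normSq_eq_norm_sq] using this.symm
  simp only [purity_partialTraceB_eq_sum]
  have hint := integrable_comp_mulVec ψ.ofLp (continuous_sum_purityTerm d)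
  have havg := haarAverage_sum_purityTerm hd.pos ψ.ofLp hnorm
  exact ⟨hint, havg⟩
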